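/- Fix integers $d\ge 1$, $R\ge 0$ and real numbers $\sigma$, $\epsilon>0$, $K<\infty$. For each size $(N_1,\dots,N_d)$ observe a $d$-way tensor $\mathbf Y\in\mathbb R^{N_1\times\dots\times N_d}$, $$\mathbf Y=\sum_{r=1}^R\bigotimes_{j=1}^d v_{j,r}+\mathbf U ,$$ where the $v_{j,r}\in\mathbb R^{N_j}$ are non-random vectors. Put $\sigma_r=\prod_{j=1}^d\|v_{j,r}\|$, $m_{j,r}=v_{j,r}/\|v_{j,r}\|$ and $M_j=(m_{j,1},\dots,m_{j,R})$. Suppose that, for sizes tending jointly to infinity, $N_1,\dots,N_d\to\infty$: (a) for every $j$ the vectors $v_{j,1},\dots,v_{j,R}$ are pairwise orthogonal; (b) the entries $u$ of $\mathbf U$ are i.i.d. with $\mathbb E u=0$, $\mathrm{Var}(u)=\sigma^2$ and $\mathbb E|u|^{4+\epsilon}\le K$, where $\sigma,\epsilon,K$ do not depend on the sizes (in particular this holds if the law of $u$ is fixed and has a finite moment of order $4+\epsilon$); (c) there are constants $d_1>d_2>\dots>d_R>0$ such that $\sigma_r^2/\prod_{j=1}^dN_j\to d_r$ for every $r\le R$.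 Let $\mathbf Y_{(j)}$ be the $N_j\times\prod_{k\ne j}N_k$ matrix whose columns are the mode-$j$ fibers of $\mathbf Y$, and let $\widehat M_j=(\hat m_{j,1},\dots,\hat m_{j,R})$, where $\hat m_{j,r}$ is a unit norm eigenvector of $\mathbf Y_{(j)}\mathbf Y_{(j)}^\top$ for its $r$-th largest eigenvalue (counted with multiplicity), with the sign chosen so that $\langle\hat m_{j,r},m_{j,r}\rangle\ge0$. With $\|A\|_{2,1}$ the sum of the Euclidean norms of the columns of $A$, for every $j\le d$, $$\|\widehat M_j-M_j\|_{2,1}=O_P\left(\sqrt{\frac1{\prod_{k\ne j}N_k}}\vee\frac1{N_j}\right).$$ In particular, if $d=3$ and $N_1,N_2,N_3$ grow proportionally to some $N$ (each $N_k/N$ is eventually bounded away from $0$ and from $\infty$), then $\|\widehat M_j-M_j\|_{2,1}=O_P(1/N)$ for $j=1,2,3$. -/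

import Mathlib

open Filter Topology MeasureTheory ProbabilityTheory

namespace TensorPCA

noncomputable section

/-- A `d`-way real tensor of size `N 0 × ⋯ × N (d - 1)`. -/
abbrev Tensor {d : ℕ} (N : Fin d → ℕ) : Type := ((k : Fin d) → Fin (N k)) → ℝ

/-- The mode-`j` unfolding: the mode-`j` fibers of the tensor are the columns of the matrix.
The `∏_{k ≠ j} N k` columns are indexed by the multi-indices `(i_k)_{k ≠ j}`. -/
def unfold {d : ℕ} {N : Fin d → ℕ} (Y : Tensor N) (j : Fin d) :
    Matrix (Fin (N j)) ((k : {k : Fin d // k ≠ j}) → Fin (N k)) ℝ :=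
  Matrix.of fun i c => Y ((Equiv.piSplitAt j fun k => Fin (N k)).symm (i, c))

/-- The Euclidean norm of the `r`-th column of a matrix. -/
def colNorm {p R : ℕ} (A : Matrix (Fin p) (Fin R) ℝ) (r : Fin R) : ℝ :=
  Real.sqrt (∑ i, A i r ^ 2)

/-- The `ℓ_{2,1}` norm: the sum of the Euclidean norms of the columns. -/
def norm21 {p R : ℕ} (A : Matrix (Fin p) (Fin R) ℝ) : ℝ := ∑ r, colNorm A r

/-- The matrix whose columns are those of `A`, divided by their Euclidean norms. -/
def normalizeCols {p R : ℕ} (A : Matrix (Fin p) (Fin R) ℝ) : Matrix (Fin p) (Fin R) ℝ :=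
  Matrix.of fun i r => A i r / colNorm A r

/-- The low-rank tensor `∑ r, v_{1,r} ⊗ ⋯ ⊗ v_{d,r}`, where `v_{k,r}` is the `r`-th column
of `V k`. -/
def signal {d R : ℕ} {N : Fin d → ℕ} (V : (k : Fin d) → Matrix (Fin (N k)) (Fin R) ℝ) :
    Tensor N :=
  fun i => ∑ r, ∏ k, V k (i k) r

/-- The scale component `σ_r = ∏ k, ‖v_{k,r}‖`. -/
def scale {d R : ℕ} {N : Fin d → ℕ} (V : (k : Fin d) → Matrix (Fin (N k)) (Fin R) ℝ)
    (r : Fin R) : ℝ :=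
  ∏ k, colNorm (V k) r

theorem isHermitian_mul_transpose {p : ℕ} {C : Type*} [Fintype C] (A : Matrix (Fin p) C ℝ) :
    (A * A.transpose).IsHermitian := by
  simpa using Matrix.isHermitian_mul_conjTranspose_self A

/-- The `r`-th largest eigenvalue (counted from `r = 0`, with multiplicity) of `A * Aᵀ`. -/
def gramEigenvalue {p : ℕ} {C : Type*} [Fintype C] (A : Matrix (Fin p) C ℝ) (r : Fin p) : ℝ :=
  (isHermitian_mul_transpose A).eigenvalues₀ (Fin.cast (Fintype.card_fin p).symm r)

/-- `Mhat` is a PCA estimate of `M` from the matrix `A`: its `r`-th column is a unit norm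
eigenvector of `A * Aᵀ` for the `r`-th largest eigenvalue, with its sign chosen so that its inner
product with the `r`-th column of `M` is nonnegative. (The condition on column `r` is void
if `A` has so few rows that `A * Aᵀ` has no `r`-th eigenvalue.) -/
def IsPCAEstimate {p R : ℕ} {C : Type*} [Fintype C] (A : Matrix (Fin p) C ℝ)
    (M Mhat : Matrix (Fin p) (Fin R) ℝ) : Prop :=
  ∀ (r : Fin R) (h : (r : ℕ) < p),
    colNorm Mhat r = 1 ∧
    (A * A.transpose).mulVec (fun i => Mhat i r)
      = gramEigenvalue A ⟨r, h⟩ • (fun i => Mhat i r) ∧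
    0 ≤ ∑ i, Mhat i r * M i r

/-- The entries of the random tensor `U` are i.i.d. with mean `0`, variance `σ ^ 2` and absolute
moment of order `q` at most `K`. -/
structure IsIIDNoise {d : ℕ} {N : Fin d → ℕ} {Ω : Type*} [MeasurableSpace Ω] (P : Measure Ω)
    (U : Ω → Tensor N) (σ q K : ℝ) : Prop where
  aemeasurable : ∀ i, AEMeasurable (fun ω => U ω i) P
  indep : iIndepFun (fun i ω => U ω i) P
  ident : ∀ i i', IdentDistrib (fun ω => U ω i) (fun ω => U ω i') P P
  mean : ∀ i, ∫ ω, U ω i ∂P = 0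
  variance : ∀ i, variance (fun ω => U ω i) P = σ ^ 2
  integrable_moment : ∀ i, Integrable (fun ω => |U ω i| ^ q) P
  moment_le : ∀ i, ∫ ω, |U ω i| ^ q ∂P ≤ K

/-- Stochastic boundedness, `X n = O_P (a n)` along the filter `l`. -/
def IsBigOP {ι : Type*} (l : Filter ι) {Ω : ι → Type*} [∀ n, MeasurableSpace (Ω n)]
    (P : (n : ι) → Measure (Ω n)) (X : (n : ι) → Ω n → ℝ) (a : ι → ℝ) : Prop :=
  ∀ η : ℝ, 0 < η → ∃ C : ℝ, 0 < C ∧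
    ∀ᶠ n in l, P n {ω | C * a n < |X n ω|} ≤ ENNReal.ofReal η

end

end TensorPCA

/-! Write the mode-`j` unfolding as `A = M * diagonal τ * Wᵀ + E`, with `τ` the scales and `Q = ∏_{k
≠ j} N k` its number of columns. For `d ≥ 2`, both `M` and `W` have orthonormal columns. Then `A *
Aᵀ = M * diagonal (τ ^ 2) * Mᵀ + c • 1 + residual` with `c = Q * σ ^ 2`, the mean of the diagonal of
`E * Eᵀ`. The shift `c • 1` moves no eigenvector, so only the residual causes an error.

Deterministic half (`IsPCAEstimate.colNorm_sub_sq_le`): Weyl's inequality locates the eigenvalues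
and a sine-theta argument the eigenvectors, so each squared column error is at most a constant times
the squared Frobenius norm of the residual over the squared gap.

Random half (`IsIIDNoise.integral_noise_le`): the residual consists of the cross terms and the
centred matrix `E * Eᵀ - c • 1`. Second moments of entries, computed from pairwise independence and
fourth moments, give an expected squared Frobenius norm of order `N j ^ 2 * Q`. The gap has order `N
j * Q`, so the squared error has order `1 / Q`, and Markov's inequality concludes.

Thus for `d ≥ 2` the first term of the maximum alone is a valid rate. For `d = 1` the product is
empty, the rate is at least `1`, and unit columns suffice. -/

namespace TensorPCA

/-! ### Eigenvalue and eigenvector perturbation in an inner product space. -/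

section SpectralPerturbation

variable {E : Type*} [NormedAddCommGroup E] [InnerProductSpace ℝ E]

theorem sum_inner_sq_le_norm_sq {κ : Type*} [Fintype κ] {v : κ → E} (hv : Orthonormal ℝ v)
    (x : E) : ∑ i, inner ℝ (v i) x ^ 2 ≤ ‖x‖ ^ 2 := by
  simpa using hv.sum_inner_products_le (x := x) (s := Finset.univ)

theorem norm_sq_sum_smul {κ : Type*} [Fintype κ] {v : κ → E} (hv : Orthonormal ℝ v)
    (c : κ → ℝ) : ‖∑ i, c i • v i‖ ^ 2 = ∑ i, c i ^ 2 := by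
  rw [← real_inner_self_eq_norm_sq, hv.inner_sum]
  simp [sq]

/-- A vector in the span of `o 0, …, o k` orthogonal to `v 0, …, v (k - 1)`. -/
theorem exists_ne_zero_sum_smul_orthogonal {m n : ℕ} (o : Fin m → E) (v : Fin n → E)
    {k : ℕ} (hm : k < m) (hn : k < n) :
    ∃ c : Fin m → ℝ, c ≠ 0 ∧ (∀ i : Fin m, k < (i : ℕ) → c i = 0) ∧
      ∀ i : Fin n, (i : ℕ) < k → inner ℝ (v i) (∑ l, c l • o l) = 0 := by
  -- All conditions on `c` form one homogeneous system: row `i < k` encodes orthogonality to `v i`,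
  -- row `i > k` encodes `c i = 0`. Omitting row `k` leaves `m - 1` equations in `m` unknowns.
  let A : Matrix {i : Fin m // i ≠ ⟨k, hm⟩} (Fin m) ℝ := Matrix.of fun i l =>
    if h : (i.1 : ℕ) < k then inner ℝ (v ⟨i.1, h.trans hn⟩) (o l) else if l = i.1 then 1 else 0
  have hker : A.mulVecLin.ker ≠ ⊥ := by
    apply LinearMap.ker_ne_bot_of_finrank_lt
    simp only [Module.finrank_fintype_fun_eq_card, Fintype.card_fin]
    simpa using Fintype.card_subtype_lt (p := fun i : Fin m => i ≠ ⟨k, hm⟩)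
      (x := ⟨k, hm⟩) (by simp)
  obtain ⟨c, hc, hc0⟩ := (Submodule.ne_bot_iff _).1 hker
  have hAc : A.mulVec c = 0 := by simpa using hc
  refine ⟨c, hc0, fun i hi => ?_, fun i hi => ?_⟩
  · have := congrFun hAc ⟨i, by rintro rfl; simp at hi⟩
    simpa [A, Matrix.mulVec, dotProduct, hi.not_gt] using this
  · have := congrFun hAc ⟨⟨i, hi.trans hm⟩, by simp [Fin.ext_iff, hi.ne]⟩
    simp only [A, Matrix.mulVec, dotProduct, Matrix.of_apply, hi, dite_true, Pi.zero_apply] at this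
    simpa [inner_sum, inner_smul_right, mul_comm] using this

/-- Weyl's inequality for quadratic forms that are diagonal in orthonormal families. -/
theorem eigenvalue_le_of_quadraticForm_le {m n : ℕ} {o : Fin m → E} {o' : Fin n → E}
    (ho : Orthonormal ℝ o) (ho' : Orthonormal ℝ o') {μ : Fin m → ℝ} {ν : Fin n → ℝ}
    (hμ : Antitone μ) (hν : Antitone ν) (hν0 : ∀ i, 0 ≤ ν i) {c : ℝ}
    (h : ∀ x, ∑ i, μ i * inner ℝ (o i) x ^ 2 ≤ ∑ i, ν i * inner ℝ (o' i) x ^ 2 + c * ‖x‖ ^ 2)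
    {k : ℕ} (hm : k < m) (hn : k < n) : μ ⟨k, hm⟩ ≤ ν ⟨k, hn⟩ + c := by
  -- Courant–Fischer test vector: on it the `μ`-form is at least `μ k * ‖x‖ ^ 2` and the `ν`-form at
  -- most `ν k * ‖x‖ ^ 2`.
  obtain ⟨a, ha0, ha, hav⟩ := exists_ne_zero_sum_smul_orthogonal o o' hm hn
  set x := ∑ l, a l • o l with hx
  have hnorm : ‖x‖ ^ 2 = ∑ i, a i ^ 2 := norm_sq_sum_smul ho a
  have hpos : 0 < ‖x‖ ^ 2 := by
    rw [hnorm]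
    obtain ⟨i, hi⟩ := Function.ne_iff.1 ha0
    exact Finset.sum_pos' (fun i _ => sq_nonneg _) ⟨i, Finset.mem_univ _, sq_pos_of_ne_zero hi⟩
  have h1 : μ ⟨k, hm⟩ * ‖x‖ ^ 2 ≤ ∑ i, μ i * inner ℝ (o i) x ^ 2 := by
    rw [hnorm, Finset.mul_sum]
    refine Finset.sum_le_sum fun i _ => ?_
    rw [hx, ho.inner_right_fintype]
    rcases lt_or_ge k (i : ℕ) with hi | hi
    · simp [ha i hi]
    · exact mul_le_mul_of_nonneg_right (hμ (Fin.le_def.2 hi)) (sq_nonneg _)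
  have h2 : ∑ i, ν i * inner ℝ (o' i) x ^ 2 ≤ ν ⟨k, hn⟩ * ‖x‖ ^ 2 := by
    -- The family `o'` need not span, so only Bessel's inequality is available, and it needs `0 ≤ ν
    -- k`.
    refine le_trans ?_ (mul_le_mul_of_nonneg_left (sum_inner_sq_le_norm_sq ho' x) (hν0 _))
    rw [Finset.mul_sum]
    refine Finset.sum_le_sum fun i _ => ?_
    rcases lt_or_ge (i : ℕ) k with hi | hi
    · simp [hav i hi]
    · exact mul_le_mul_of_nonneg_right (hν (Fin.le_def.2 hi)) (sq_nonneg _)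
  have h3 := h x
  nlinarith

/-- A sine-theta bound: a unit vector that is nearly an eigenvector of `∑ s, ν s • o s ⊗ o s` for a
value separated from all `ν s`, `s ≠ r`, and from `0`, is close to `o r`. -/
theorem norm_sub_sq_le_of_approx_eigenvector {κ : Type*} [Fintype κ] {o : κ → E}
    (ho : Orthonormal ℝ o) (ν : κ → ℝ) {u : E} (hu : ‖u‖ = 1) {t D G : ℝ} (hG : 0 < G)
    (hres : ‖t • u - ∑ s, (ν s * inner ℝ (o s) u) • o s‖ ^ 2 ≤ D) {r : κ}
    (ht : G ≤ |t|) (hsep : ∀ s, s ≠ r → G ≤ |t - ν s|) (hsign : 0 ≤ inner ℝ (o r) u) :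
    ‖u - o r‖ ^ 2 ≤ 2 * D / G ^ 2 := by
  classical
  set a : κ → ℝ := fun s => inner ℝ (o s) u with ha
  -- Pythagoras: the part of `u` outside the span is scaled by `t`, its `o s` component by `t - ν
  -- s`.
  have hexp : ‖t • u - ∑ s, (ν s * a s) • o s‖ ^ 2
      = t ^ 2 * (1 - ∑ s, a s ^ 2) + ∑ s, (t - ν s) ^ 2 * a s ^ 2 := by
    have hin : inner ℝ u (∑ s, (ν s * a s) • o s) = ∑ s, ν s * a s ^ 2 := by
      rw [inner_sum]
      refine Finset.sum_congr rfl fun s _ => ?_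
      rw [inner_smul_right, real_inner_comm]; ring
    rw [norm_sub_sq_real, norm_smul, norm_sq_sum_smul ho, inner_smul_left, hin, hu]
    simp only [Real.norm_eq_abs, mul_one, sq_abs, conj_trivial, mul_sub, Finset.mul_sum]
    have : ∑ s, (t - ν s) ^ 2 * a s ^ 2 = ∑ s, t ^ 2 * a s ^ 2 - ∑ s, 2 * (t * (ν s * a s ^ 2))
        + ∑ s, (ν s * a s) ^ 2 := by
      rw [← Finset.sum_sub_distrib, ← Finset.sum_add_distrib]
      exact Finset.sum_congr rfl fun s _ => by ring
    rw [this]; ring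
  have hbes : ∑ s, a s ^ 2 ≤ 1 := by simpa [hu] using sum_inner_sq_le_norm_sq ho u
  have hG2 : G ^ 2 ≤ t ^ 2 := sq_le_sq.2 (by rwa [abs_of_pos hG])
  have h1 : G ^ 2 * (∑ s, a s ^ 2 - a r ^ 2) ≤ ∑ s, (t - ν s) ^ 2 * a s ^ 2 := by
    rw [← Finset.add_sum_erase _ (fun s => a s ^ 2) (Finset.mem_univ r),
      ← Finset.add_sum_erase _ (fun s => (t - ν s) ^ 2 * a s ^ 2) (Finset.mem_univ r),
      add_sub_cancel_left, Finset.mul_sum]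
    refine le_add_of_nonneg_of_le (by positivity) (Finset.sum_le_sum fun s hs => ?_)
    refine mul_le_mul_of_nonneg_right (sq_le_sq.2 ?_) (sq_nonneg _)
    rw [abs_of_pos hG]
    exact hsep s (Finset.ne_of_mem_erase hs)
  have h2 : G ^ 2 * (1 - a r ^ 2) ≤ D := by
    rw [hexp] at hres
    nlinarith
  have har : a r ≤ 1 := by
    simpa [hu, ho.1 r] using real_inner_le_norm (o r) u
  have h3 : ‖u - o r‖ ^ 2 = 2 - 2 * a r := by
    rw [norm_sub_sq_real, hu, ho.1 r, real_inner_comm]; ring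
  rw [le_div_iff₀ (by positivity), h3]
  -- The sign choice enters here: `0 ≤ a r ≤ 1` gives `a r ^ 2 ≤ a r`.
  have : 2 - 2 * a r ≤ 2 * (1 - a r ^ 2) := by
    have : 0 ≤ a r := hsign
    nlinarith
  nlinarith [sq_nonneg G, mul_le_mul_of_nonneg_right this (sq_nonneg G)]

end SpectralPerturbation

/-! ### Column norms and the Frobenius norm. -/

theorem colNorm_eq_norm {p R : ℕ} (A : Matrix (Fin p) (Fin R) ℝ) (r : Fin R) :
    colNorm A r = ‖WithLp.toLp 2 (fun i => A i r)‖ := by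
  simp [colNorm, EuclideanSpace.norm_eq]

theorem colNorm_sq {p R : ℕ} (A : Matrix (Fin p) (Fin R) ℝ) (r : Fin R) :
    colNorm A r ^ 2 = ∑ i, A i r ^ 2 :=
  Real.sq_sqrt (Finset.sum_nonneg fun _ _ => sq_nonneg _)

theorem colNorm_nonneg {p R : ℕ} (A : Matrix (Fin p) (Fin R) ℝ) (r : Fin R) : 0 ≤ colNorm A r :=
  Real.sqrt_nonneg _

/-- The squared Frobenius norm. -/
noncomputable def frobSq {m n : Type*} [Fintype m] [Fintype n] (A : Matrix m n ℝ) : ℝ :=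
  ∑ i, ∑ j, A i j ^ 2

theorem frobSq_nonneg {m n : Type*} [Fintype m] [Fintype n] (A : Matrix m n ℝ) : 0 ≤ frobSq A :=
  Finset.sum_nonneg fun _ _ => Finset.sum_nonneg fun _ _ => sq_nonneg _

/-- Cauchy–Schwarz in each row. Controlling the operator norm this way reduces the random part to
second moments of entries. -/
theorem norm_toEuclideanLin_sq_le {p : ℕ} (A : Matrix (Fin p) (Fin p) ℝ)
    (x : EuclideanSpace ℝ (Fin p)) :
    ‖Matrix.toEuclideanLin A x‖ ^ 2 ≤ frobSq A * ‖x‖ ^ 2 := by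
  rw [EuclideanSpace.real_norm_sq_eq, EuclideanSpace.real_norm_sq_eq, frobSq, Finset.sum_mul]
  refine Finset.sum_le_sum fun i _ => ?_
  simpa [Matrix.toLpLin_apply, Matrix.mulVec, dotProduct] using
    Finset.sum_mul_sq_le_sq_mul_sq Finset.univ (A i) x

/-! ### Spectral theory of the Gram matrix and the Davis–Kahan bound. -/

section GramMatrix

variable {p : ℕ} {C : Type*} [Fintype C] (A : Matrix (Fin p) C ℝ)

theorem gramEigenvalue_antitone : Antitone (gramEigenvalue A) := fun _ _ h =>
  (isHermitian_mul_transpose A).eigenvalues₀_antitone (by simpa using h)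

theorem exists_orthonormalBasis_gram :
    ∃ b : OrthonormalBasis (Fin p) ℝ (EuclideanSpace ℝ (Fin p)),
      ∀ i, Matrix.toEuclideanLin (A * A.transpose) (b i) = gramEigenvalue A i • b i := by
  have hs := Matrix.isSymmetric_toEuclideanLin_iff.mpr (isHermitian_mul_transpose A)
  refine ⟨(hs.eigenvectorBasis finrank_euclideanSpace).reindex
    (finCongr (Fintype.card_fin p)), fun i => ?_⟩
  rw [OrthonormalBasis.reindex_apply, hs.apply_eigenvectorBasis]
  rfl

theorem inner_toEuclideanLin_gram (b : OrthonormalBasis (Fin p) ℝ (EuclideanSpace ℝ (Fin p)))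
    (hb : ∀ i, Matrix.toEuclideanLin (A * A.transpose) (b i) = gramEigenvalue A i • b i)
    (x : EuclideanSpace ℝ (Fin p)) :
    inner ℝ x (Matrix.toEuclideanLin (A * A.transpose) x)
      = ∑ i, gramEigenvalue A i * inner ℝ (b i) x ^ 2 := by
  have hs := Matrix.isSymmetric_toEuclideanLin_iff.mpr (isHermitian_mul_transpose A)
  rw [← b.sum_inner_mul_inner]
  refine Finset.sum_congr rfl fun i _ => ?_
  rw [← hs (b i) x, hb, inner_smul_left, real_inner_comm x]
  simp; ring

theorem gramEigenvalue_nonneg (r : Fin p) : 0 ≤ gramEigenvalue A r := by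
  obtain ⟨b, hb⟩ := exists_orthonormalBasis_gram A
  have h1 : inner ℝ (b r) (Matrix.toEuclideanLin (A * A.transpose) (b r))
      = gramEigenvalue A r := by
    rw [hb, inner_smul_right, real_inner_self_eq_norm_sq, b.norm_eq_one]; simp
  rw [← h1]
  have := (Matrix.posSemidef_self_mul_conjTranspose A).dotProduct_mulVec_nonneg (b r).ofLp
  rw [EuclideanSpace.inner_eq_star_dotProduct, dotProduct_comm]
  simpa [Matrix.toLpLin_apply] using this

/-- The part of `A * Aᵀ` that is left after `c • 1 + ∑ r, s r • (M r) (M r)ᵀ` is removed. -/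
def gramResidual {R : ℕ} (M : Matrix (Fin p) (Fin R) ℝ) (s : Fin R → ℝ) (c : ℝ) :
    Matrix (Fin p) (Fin p) ℝ :=
  A * A.transpose - c • 1 - M * Matrix.diagonal s * M.transpose

variable {A}

/-- A Davis–Kahan bound for PCA estimates. -/
theorem IsPCAEstimate.colNorm_sub_sq_le {R : ℕ} (hRp : R ≤ p) {M Mhat : Matrix (Fin p) (Fin R) ℝ}
    (h : IsPCAEstimate A M Mhat) (hM : M.transpose * M = 1) {s : Fin R → ℝ} (c : ℝ) {g : ℝ}
    (hg : 0 < g) (hs : ∀ r, g ≤ s r) (hgap : ∀ r r', r < r' → g ≤ s r - s r') (r : Fin R) :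
    colNorm (Mhat - M) r ^ 2 ≤ 8 * frobSq (gramResidual A M s c) / g ^ 2 := by
  set F := frobSq (gramResidual A M s c) with hF
  have hF0 : 0 ≤ F := frobSq_nonneg _
  set D := Real.sqrt F with hD
  have hD0 : 0 ≤ D := Real.sqrt_nonneg _
  have hDF : D ^ 2 = F := Real.sq_sqrt hF0
  let o : Fin R → EuclideanSpace ℝ (Fin p) := fun r => WithLp.toLp 2 (fun i => M i r)
  have ho_inner (r : Fin R) (x : EuclideanSpace ℝ (Fin p)) :
      inner ℝ (o r) x = ∑ i, M i r * x i := by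
    simp [o, PiLp.inner_apply, mul_comm]
  have ho : Orthonormal ℝ o := by
    rw [orthonormal_iff_ite]
    intro r r'
    rw [ho_inner]
    simpa [Matrix.mul_apply, Matrix.one_apply] using congrFun (congrFun hM r) r'
  set T := Matrix.toEuclideanLin (A * A.transpose) with hT
  have hres (x : EuclideanSpace ℝ (Fin p)) :
      T x - c • x - ∑ r, (s r * inner ℝ (o r) x) • o r
        = Matrix.toEuclideanLin (gramResidual A M s c) x := by
    have h1 : ∑ r, (s r * inner ℝ (o r) x) • o r
        = Matrix.toEuclideanLin (M * Matrix.diagonal s * M.transpose) x := by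
      ext i
      simp only [Matrix.toLpLin_apply, WithLp.ofLp_sum, Finset.sum_apply, ← Matrix.mulVec_mulVec,
        ho_inner, o]
      simp [Matrix.mulVec, dotProduct, Matrix.diagonal_apply, mul_comm]
    rw [h1, gramResidual, map_sub, map_sub, map_smul]
    simp [hT, Matrix.toLpLin_one]
  have hresle (x : EuclideanSpace ℝ (Fin p)) :
      ‖T x - c • x - ∑ r, (s r * inner ℝ (o r) x) • o r‖ ^ 2 ≤ F * ‖x‖ ^ 2 := by
    rw [hres]; exact norm_toEuclideanLin_sq_le _ _
  obtain ⟨b, hb⟩ := exists_orthonormalBasis_gram A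
  have hquad (x : EuclideanSpace ℝ (Fin p)) :
      |∑ i, gramEigenvalue A i * inner ℝ (b i) x ^ 2 - c * ‖x‖ ^ 2
        - ∑ r, s r * inner ℝ (o r) x ^ 2| ≤ D * ‖x‖ ^ 2 := by
    have h1 : inner ℝ x (T x - c • x - ∑ r, (s r * inner ℝ (o r) x) • o r)
        = ∑ i, gramEigenvalue A i * inner ℝ (b i) x ^ 2 - c * ‖x‖ ^ 2
          - ∑ r, s r * inner ℝ (o r) x ^ 2 := by
      rw [inner_sub_right, inner_sub_right, inner_toEuclideanLin_gram A b hb, inner_smul_right,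
        real_inner_self_eq_norm_sq, inner_sum]
      congr 1
      refine Finset.sum_congr rfl fun r _ => ?_
      rw [inner_smul_right, real_inner_comm x]; ring
    rw [← h1]
    refine (abs_real_inner_le_norm _ _).trans ?_
    have h2 : ‖T x - c • x - ∑ r, (s r * inner ℝ (o r) x) • o r‖ ≤ D * ‖x‖ := by
      refine abs_le_of_sq_le_sq' ?_ (by positivity) |>.2
      rw [mul_pow, hDF]; exact hresle x
    nlinarith [norm_nonneg x]
  have hsanti : Antitone s := fun i k hik => by
    rcases hik.eq_or_lt with rfl | hlt
    · exact le_rfl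
    · linarith [hgap i k hlt]
  have hr : (r : ℕ) < p := r.2.trans_le hRp
  obtain ⟨hunit, heig, hsign⟩ := h r hr
  set μ := gramEigenvalue A ⟨r, hr⟩ with hμ
  -- Weyl in both directions gives `|μ - c - s r| ≤ D`.
  have hup : μ ≤ s r + (c + D) :=
    eigenvalue_le_of_quadraticForm_le b.orthonormal ho (gramEigenvalue_antitone A) hsanti
      (fun i => hg.le.trans (hs i)) (fun x => by linarith [(abs_le.1 (hquad x)).2]) hr r.2
  have hlo : s r ≤ μ + (D - c) :=
    eigenvalue_le_of_quadraticForm_le ho b.orthonormal hsanti (gramEigenvalue_antitone A)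
      (gramEigenvalue_nonneg A) (fun x => by linarith [(abs_le.1 (hquad x)).1]) r.2 hr
  set u : EuclideanSpace ℝ (Fin p) := WithLp.toLp 2 (fun i => Mhat i r) with hu
  have hu1 : ‖u‖ = 1 := by rw [← hunit, colNorm_eq_norm]
  have hTu : T u = μ • u := by
    rw [hT, Matrix.toLpLin_apply, hu, heig]; rfl
  have hou : 0 ≤ inner ℝ (o r) u := by
    rw [ho_inner]; simpa [hu, mul_comm] using hsign
  have hdist : colNorm (Mhat - M) r = ‖u - o r‖ := by
    rw [colNorm_eq_norm]; rfl
  rw [hdist]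
  -- If `D ≤ g / 2`, then `μ - c` keeps distance `g / 2` from `0` and from the other `s r'`, whence
  -- the constant `8 = 2 / (1 / 2) ^ 2`. Otherwise the bound exceeds `2`, and the sign condition
  -- alone gives `‖u - o r‖ ^ 2 ≤ 2`.
  rcases le_or_gt D (g / 2) with hDg | hDg
  · have hsep (r' : Fin R) (hr' : r' ≠ r) : g / 2 ≤ |μ - c - s r'| := by
      rcases lt_or_gt_of_ne hr' with h1 | h1
      · have := hgap _ _ h1
        rw [abs_sub_comm]; exact le_trans (by linarith) (le_abs_self _)
      · have := hgap _ _ h1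
        exact le_trans (by linarith) (le_abs_self _)
    have h0 : g / 2 ≤ |μ - c| := le_trans (by linarith [hs r]) (le_abs_self _)
    have hresu := hresle u
    rw [hTu, ← sub_smul, hu1] at hresu
    refine (norm_sub_sq_le_of_approx_eigenvector ho s hu1 (half_pos hg) hresu h0 hsep hou).trans
      (le_of_eq ?_)
    field_simp; ring
  · rw [norm_sub_sq_real, hu1, ho.1 r, real_inner_comm, le_div_iff₀ (by positivity), ← hDF]
    nlinarith

end GramMatrix

/-! ### The Gram residual of a low-rank matrix plus noise. -/

section Frobenius

theorem frobSq_eq_trace {m n : Type*} [Fintype m] [Fintype n] (A : Matrix m n ℝ) :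
    frobSq A = (A.transpose * A).trace := by
  rw [frobSq, Finset.sum_comm]
  simp [Matrix.trace, Matrix.mul_apply, sq]

theorem frobSq_transpose {m n : Type*} [Fintype m] [Fintype n] (A : Matrix m n ℝ) :
    frobSq A.transpose = frobSq A := by
  simp only [frobSq, Matrix.transpose_apply]
  exact Finset.sum_comm

theorem frobSq_mul_of_orthonormal {m n k : Type*} [Fintype m] [Fintype n] [Fintype k]
    [DecidableEq k] {M : Matrix m k ℝ} (hM : M.transpose * M = 1) (B : Matrix k n ℝ) :
    frobSq (M * B) = frobSq B := by
  rw [frobSq_eq_trace, frobSq_eq_trace, Matrix.transpose_mul, Matrix.mul_assoc,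
    ← Matrix.mul_assoc M.transpose, hM, Matrix.one_mul]

theorem frobSq_add_add_le {m n : Type*} [Fintype m] [Fintype n] (A B D : Matrix m n ℝ) :
    frobSq (A + B + D) ≤ 3 * (frobSq A + frobSq B + frobSq D) := by
  simp only [frobSq, ← Finset.sum_add_distrib, Finset.mul_sum]
  refine Finset.sum_le_sum fun i _ => Finset.sum_le_sum fun j _ => ?_
  simp only [Matrix.add_apply]
  nlinarith [sq_nonneg (A i j - B i j), sq_nonneg (A i j - D i j), sq_nonneg (B i j - D i j)]

/-- The residual of the Gram matrix of a low-rank matrix plus noise, in terms of the noise. -/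
theorem frobSq_gramResidual_le {p R : ℕ} {C : Type*} [Fintype C] {M : Matrix (Fin p) (Fin R) ℝ}
    {W : Matrix C (Fin R) ℝ} (hM : M.transpose * M = 1) (hW : W.transpose * W = 1)
    (τ : Fin R → ℝ) (E : Matrix (Fin p) C ℝ) (c : ℝ) :
    frobSq (gramResidual (M * Matrix.diagonal τ * W.transpose + E) M (fun r => τ r ^ 2) c)
      ≤ 3 * (2 * ∑ r, τ r ^ 2 * ∑ i, (E * W) i r ^ 2 + frobSq (E * E.transpose - c • 1)) := by
  -- The cross terms are `M * G` and its transpose, and left multiplication by `M` preserves the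
  -- Frobenius norm.
  set G := Matrix.diagonal τ * (E * W).transpose with hG
  have hres : gramResidual (M * Matrix.diagonal τ * W.transpose + E) M (fun r => τ r ^ 2) c
      = M * G + (M * G).transpose + (E * E.transpose - c • 1) := by
    have hd : (Matrix.diagonal fun r => τ r ^ 2) = Matrix.diagonal τ * Matrix.diagonal τ := by
      simp [sq]
    have h1 : M * Matrix.diagonal τ * W.transpose * (W * Matrix.diagonal τ * M.transpose)
        = M * (Matrix.diagonal τ * Matrix.diagonal τ) * M.transpose := by
      calc _ = M * Matrix.diagonal τ * (W.transpose * W) * Matrix.diagonal τ * M.transpose := by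
            simp only [Matrix.mul_assoc]
        _ = _ := by rw [hW]; simp only [Matrix.mul_assoc, Matrix.one_mul]
    have h2 : (M * Matrix.diagonal τ * W.transpose + E).transpose
        = W * Matrix.diagonal τ * M.transpose + E.transpose := by
      simp [Matrix.transpose_mul, Matrix.mul_assoc]
    rw [gramResidual, h2, Matrix.add_mul, Matrix.mul_add, Matrix.mul_add, h1, hd, hG]
    simp only [Matrix.transpose_mul, Matrix.transpose_transpose, Matrix.diagonal_transpose,
      Matrix.mul_assoc]
    abel
  have hfrob : frobSq (M * G) = ∑ r, τ r ^ 2 * ∑ i, (E * W) i r ^ 2 := by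
    rw [frobSq_mul_of_orthonormal hM, frobSq]
    refine Finset.sum_congr rfl fun r _ => ?_
    rw [Finset.mul_sum]
    refine Finset.sum_congr rfl fun i _ => ?_
    rw [hG, Matrix.diagonal_mul, Matrix.transpose_apply, mul_pow]
  rw [hres]
  refine (frobSq_add_add_le _ _ _).trans (le_of_eq ?_)
  rw [frobSq_transpose, hfrob]; ring

end Frobenius

/-! ### The unfolded signal as a singular value decomposition. -/

section Tensor

variable {d R : ℕ} {N : Fin d → ℕ}

/-- The unit norm right factors of the mode-`j` unfolding of a low-rank tensor. -/
noncomputable def rightFactors (V : (k : Fin d) → Matrix (Fin (N k)) (Fin R) ℝ) (j : Fin d) :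
    Matrix ((k : {k : Fin d // k ≠ j}) → Fin (N k)) (Fin R) ℝ :=
  Matrix.of fun c r => ∏ k : {k : Fin d // k ≠ j}, normalizeCols (V k) (c k) r

variable {V : (k : Fin d) → Matrix (Fin (N k)) (Fin R) ℝ}

theorem colNorm_ne_zero_of_scale_ne_zero {r : Fin R} (h : scale V r ≠ 0) (k : Fin d) :
    colNorm (V k) r ≠ 0 :=
  Finset.prod_ne_zero_iff.1 h k (Finset.mem_univ k)

theorem normalizeCols_orthonormal {p : ℕ} {A : Matrix (Fin p) (Fin R) ℝ}
    (hA : (A.transpose * A).IsDiag) (h : ∀ r, colNorm A r ≠ 0) :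
    (normalizeCols A).transpose * normalizeCols A = 1 := by
  ext r r'
  have h1 : ((normalizeCols A).transpose * normalizeCols A) r r'
      = (A.transpose * A) r r' / (colNorm A r * colNorm A r') := by
    simp only [Matrix.mul_apply, Matrix.transpose_apply, normalizeCols, Matrix.of_apply,
      Finset.sum_div]
    exact Finset.sum_congr rfl fun i _ => div_mul_div_comm _ _ _ _
  rw [h1]
  rcases eq_or_ne r r' with rfl | hr
  · have h2 : (A.transpose * A) r r = colNorm A r * colNorm A r := by
      rw [← sq, colNorm_sq]; simp [Matrix.mul_apply, sq]
    rw [h2, div_self (mul_ne_zero (h r) (h r)), Matrix.one_apply_eq]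
  · rw [hA hr, zero_div, Matrix.one_apply_ne hr]

/-- The Gram matrix of columnwise tensor products is the entrywise product of the Gram matrices.
With `d ≥ 2` some mode `k ≠ j` exists and kills the off-diagonal entries. -/
theorem rightFactors_orthonormal (hd : 2 ≤ d) (hV : ∀ k, ((V k).transpose * V k).IsDiag)
    (h : ∀ r, scale V r ≠ 0) (j : Fin d) :
    (rightFactors V j).transpose * rightFactors V j = 1 := by
  ext r r'
  have h1 : ((rightFactors V j).transpose * rightFactors V j) r r'
      = ∏ k : {k : Fin d // k ≠ j},
          ((normalizeCols (V k)).transpose * normalizeCols (V k)) r r' := by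
    simp only [Matrix.mul_apply, Matrix.transpose_apply, rightFactors, Matrix.of_apply,
      Finset.prod_univ_sum, Fintype.piFinset_univ, Finset.prod_mul_distrib]
  rw [h1]
  simp only [normalizeCols_orthonormal (hV _)
    fun r => colNorm_ne_zero_of_scale_ne_zero (h r) _]
  rcases eq_or_ne r r' with rfl | hr
  · simp
  · have : Nontrivial (Fin d) := Fin.nontrivial_iff_two_le.2 hd
    obtain ⟨k, hk⟩ := exists_ne j
    rw [Matrix.one_apply_ne hr]
    exact Finset.prod_eq_zero (Finset.mem_univ ⟨k, hk⟩) rfl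

theorem unfold_signal (h : ∀ r, scale V r ≠ 0) (j : Fin d) :
    unfold (signal V) j
      = normalizeCols (V j) * Matrix.diagonal (scale V) * (rightFactors V j).transpose := by
  ext i c
  simp only [unfold, signal, Matrix.of_apply, Matrix.mul_apply (M := _ * _), Matrix.mul_diagonal,
    Matrix.transpose_apply, rightFactors]
  refine Finset.sum_congr rfl fun r _ => ?_
  have hne := colNorm_ne_zero_of_scale_ne_zero (h r)
  have h2 (f : Fin d → ℝ) : ∏ k, f k = f j * ∏ k : {k : Fin d // k ≠ j}, f k := by
    rw [← Finset.mul_prod_erase _ _ (Finset.mem_univ j)]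
    congr 1
    exact Finset.prod_subtype _ (by simp) f
  rw [scale, h2, h2]
  simp only [normalizeCols, Matrix.of_apply, Finset.prod_div_distrib]
  have hj := hne j
  have hprod : ∏ k : {k : Fin d // k ≠ j}, colNorm (V k) r ≠ 0 :=
    Finset.prod_ne_zero_iff.2 fun k _ => hne k
  have h3 : (Equiv.piSplitAt j fun k => Fin (N k)).symm (i, c) j = i := by
    simp [Equiv.piSplitAt]
  have h4 (k : {k : Fin d // k ≠ j}) :
      (Equiv.piSplitAt j fun k => Fin (N k)).symm (i, c) k = c k := by
    simp [Equiv.piSplitAt, k.2]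
  rw [h3]
  simp only [h4]
  field_simp

theorem unfold_add (X Y : Tensor N) (j : Fin d) : unfold (X + Y) j = unfold X j + unfold Y j := rfl

end Tensor

/-! ### Second moments of the noise terms. -/

section Moments

variable {Ω : Type*} [MeasurableSpace Ω] {P : Measure Ω}

theorem integral_sum_sq_le [IsProbabilityMeasure P] {κ : Type*} [Fintype κ] {X : κ → Ω → ℝ}
    (hX : ∀ c, MemLp (X c) 2 P) (hmean : ∀ c, ∫ ω, X c ω ∂P = 0)
    (hind : Pairwise fun c c' => X c ⟂ᵢ[P] X c') {v : κ → ℝ} (hv : ∀ c, Var[X c; P] ≤ v c) :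
    Integrable (fun ω => (∑ c, X c ω) ^ 2) P ∧ ∫ ω, (∑ c, X c ω) ^ 2 ∂P ≤ ∑ c, v c := by
  have hmem : MemLp (∑ c, X c) 2 P := memLp_finsetSum' _ fun c _ => hX c
  have hint : Integrable (fun ω => (∑ c, X c ω) ^ 2) P := by
    simpa using hmem.integrable_sq
  refine ⟨hint, ?_⟩
  have hm0 : ∫ ω, (∑ c, X c) ω ∂P = 0 := by
    simp only [Finset.sum_apply]
    rw [integral_finsetSum _ fun c _ => (hX c).integrable one_le_two]
    simp [hmean]
  have hvar : Var[∑ c, X c; P] = ∫ ω, (∑ c, X c ω) ^ 2 ∂P := by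
    rw [variance_of_integral_eq_zero hmem.aestronglyMeasurable.aemeasurable hm0]
    simp
  rw [← hvar, IndepFun.variance_sum (fun c _ => hX c) fun c _ c' _ h => hind h]
  exact Finset.sum_le_sum fun c _ => hv c

theorem pow_four_le_one_add_rpow {q : ℝ} (hq : 4 ≤ q) (x : ℝ) : x ^ 4 ≤ 1 + |x| ^ q := by
  have h4 : x ^ 4 = |x| ^ (4 : ℝ) := by
    rw [show (4 : ℝ) = ((4 : ℕ) : ℝ) by norm_num, Real.rpow_natCast, Even.pow_abs (by decide)]
  rw [h4]
  rcases le_or_gt |x| 1 with h | h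
  · have := Real.rpow_le_one (abs_nonneg x) h (by norm_num : (0 : ℝ) ≤ 4)
    have := Real.rpow_nonneg (abs_nonneg x) q
    linarith
  · have := Real.rpow_le_rpow_of_exponent_le h.le hq
    linarith

namespace IsIIDNoise

variable {d : ℕ} {N : Fin d → ℕ} {U : Ω → Tensor N} {σ q K : ℝ}

theorem integrable_pow_four [IsProbabilityMeasure P] (hU : IsIIDNoise P U σ q K) (hq : 4 ≤ q)
    (a : (k : Fin d) → Fin (N k)) :
    Integrable (fun ω => U ω a ^ 4) P := by
  refine ((integrable_const 1).add (hU.integrable_moment a)).mono'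
    ((hU.aemeasurable a).pow_const 4).aestronglyMeasurable (ae_of_all _ fun ω => ?_)
  rw [Real.norm_of_nonneg (by positivity)]
  exact pow_four_le_one_add_rpow hq _

theorem integral_pow_four_le [IsProbabilityMeasure P] (hU : IsIIDNoise P U σ q K) (hq : 4 ≤ q)
    (a : (k : Fin d) → Fin (N k)) :
    ∫ ω, U ω a ^ 4 ∂P ≤ 1 + K := by
  calc _ ≤ ∫ ω, (1 + |U ω a| ^ q) ∂P :=
        integral_mono (hU.integrable_pow_four hq a)
          ((integrable_const 1).add (hU.integrable_moment a))
          fun ω => pow_four_le_one_add_rpow hq _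
    _ ≤ 1 + K := by
        rw [integral_add (integrable_const 1) (hU.integrable_moment a)]
        simpa using hU.moment_le a

theorem memLp_two [IsProbabilityMeasure P] (hU : IsIIDNoise P U σ q K) (hq : 4 ≤ q)
    (a : (k : Fin d) → Fin (N k)) : MemLp (fun ω => U ω a) 2 P := by
  rw [memLp_two_iff_integrable_sq (hU.aemeasurable a).aestronglyMeasurable]
  refine ((integrable_const 1).add (hU.integrable_pow_four hq a)).mono'
    ((hU.aemeasurable a).pow_const 2).aestronglyMeasurable (ae_of_all _ fun ω => ?_)
  rw [Real.norm_of_nonneg (by positivity)]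
  simp only [Pi.add_apply]
  nlinarith [sq_nonneg (U ω a ^ 2 - 1), sq_nonneg (U ω a ^ 2)]

theorem memLp_two_mul [IsProbabilityMeasure P] (hU : IsIIDNoise P U σ q K) (hq : 4 ≤ q)
    (a b : (k : Fin d) → Fin (N k)) :
    MemLp (fun ω => U ω a * U ω b) 2 P := by
  have hm : AEMeasurable (fun ω => U ω a * U ω b) P :=
    (hU.aemeasurable a).mul (hU.aemeasurable b)
  rw [memLp_two_iff_integrable_sq hm.aestronglyMeasurable]
  refine ((hU.integrable_pow_four hq a).add (hU.integrable_pow_four hq b)).mono'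
    (hm.pow_const 2).aestronglyMeasurable (ae_of_all _ fun ω => ?_)
  rw [Real.norm_of_nonneg (by positivity)]
  simp only [Pi.add_apply]
  nlinarith [sq_nonneg (U ω a ^ 2 - U ω b ^ 2), sq_nonneg (U ω a ^ 2), sq_nonneg (U ω b ^ 2)]

theorem variance_mul_le [IsProbabilityMeasure P] (hU : IsIIDNoise P U σ q K) (hq : 4 ≤ q)
    (a b : (k : Fin d) → Fin (N k)) :
    Var[fun ω => U ω a * U ω b; P] ≤ 1 + K := by
  refine (variance_le_expectation_sq
    (hU.memLp_two_mul hq a b).aestronglyMeasurable).trans ?_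
  calc ∫ ω, (U ω a * U ω b) ^ 2 ∂P
      ≤ ∫ ω, (U ω a ^ 4 / 2 + U ω b ^ 4 / 2) ∂P :=
        integral_mono (hU.memLp_two_mul hq a b).integrable_sq
          (((hU.integrable_pow_four hq a).div_const 2).add
            ((hU.integrable_pow_four hq b).div_const 2))
          fun ω => by
            simp only []
            nlinarith [sq_nonneg (U ω a ^ 2 - U ω b ^ 2)]
    _ ≤ 1 + K := by
        rw [integral_add ((hU.integrable_pow_four hq a).div_const 2)
          ((hU.integrable_pow_four hq b).div_const 2), integral_div, integral_div]
        linarith [hU.integral_pow_four_le hq a, hU.integral_pow_four_le hq b]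

theorem integral_mul (hU : IsIIDNoise P U σ q K)
    (a b : (k : Fin d) → Fin (N k)) :
    ∫ ω, U ω a * U ω b ∂P = if a = b then σ ^ 2 else 0 := by
  split_ifs with hab
  · subst hab
    rw [← hU.variance a, variance_of_integral_eq_zero (hU.aemeasurable a) (hU.mean a)]
    simp [sq]
  · have := (hU.indep.indepFun hab).integral_mul_eq_mul_integral
      (hU.aemeasurable a).aestronglyMeasurable (hU.aemeasurable b).aestronglyMeasurable
    simpa [hU.mean] using this

theorem integral_sum_mul_sq_le [IsProbabilityMeasure P] (hU : IsIIDNoise P U σ q K) (hq : 4 ≤ q)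
    {κ : Type*} [Fintype κ] {φ : κ → (k : Fin d) → Fin (N k)}
    (hφ : Function.Injective φ) {w : κ → ℝ} (hw : ∑ c, w c ^ 2 = 1) :
    Integrable (fun ω => (∑ c, U ω (φ c) * w c) ^ 2) P ∧
      ∫ ω, (∑ c, U ω (φ c) * w c) ^ 2 ∂P ≤ σ ^ 2 := by
  have key := integral_sum_sq_le (P := P) (X := fun c ω => U ω (φ c) * w c)
    (v := fun c => w c ^ 2 * σ ^ 2)
    (fun c => (hU.memLp_two hq (φ c)).mul_const (w c))
    (fun c => by rw [integral_mul_const, hU.mean, zero_mul])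
    (fun c c' h => (hU.indep.indepFun (hφ.ne h)).comp
      (measurable_id.mul_const (w c)) (measurable_id.mul_const (w c')))
    (fun c => by rw [variance_mul_const, hU.variance, mul_comm])
  rwa [← Finset.sum_mul, hw, one_mul] at key

/-- For `c ≠ c'` the index pairs `(φ c, ψ c)` and `(φ c', ψ c')` are disjoint, so the centred
products are pairwise independent and their variances add. Allowing `φ c = ψ c` covers the diagonal
of the noise Gram matrix. -/
theorem integral_sum_mul_sub_sq_le [IsProbabilityMeasure P] (hU : IsIIDNoise P U σ q K) (hq : 4 ≤ q)
    {κ : Type*} [Fintype κ] {φ ψ : κ → (k : Fin d) → Fin (N k)}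
    (hφ : Function.Injective φ) (hψ : Function.Injective ψ)
    (hφψ : ∀ c c', c ≠ c' → φ c ≠ ψ c') {m : ℝ}
    (hm : ∀ c, m = if φ c = ψ c then σ ^ 2 else 0) :
    Integrable (fun ω => (∑ c, (U ω (φ c) * U ω (ψ c) - m)) ^ 2) P ∧
      ∫ ω, (∑ c, (U ω (φ c) * U ω (ψ c) - m)) ^ 2 ∂P ≤ Fintype.card κ * (1 + K) := by
  have key := integral_sum_sq_le (P := P) (X := fun c ω => U ω (φ c) * U ω (ψ c) - m)
    (v := fun _ => 1 + K)
    (fun c => (hU.memLp_two_mul hq _ _).sub (memLp_const m))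
    (fun c => by
      rw [integral_sub ((hU.memLp_two_mul hq _ _).integrable one_le_two) (integrable_const m),
        hU.integral_mul, ← hm c]
      simp)
    (fun c c' h => (hU.indep.indepFun_prodMk_prodMk₀ hU.aemeasurable (φ c) (ψ c) (φ c') (ψ c')
        (hφ.ne h) (hφψ _ _ h) (hφψ _ _ h.symm).symm (hψ.ne h)).comp
      (φ := fun x : ℝ × ℝ => x.1 * x.2 - m) (ψ := fun x : ℝ × ℝ => x.1 * x.2 - m)
      (by fun_prop) (by fun_prop))
    (fun c => by
      rw [variance_sub_const (hU.memLp_two_mul hq _ _).aestronglyMeasurable]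
      exact hU.variance_mul_le hq _ _)
  rwa [Finset.sum_const, Finset.card_univ, nsmul_eq_mul] at key

/-- The expected squared Frobenius norms of the two noise terms in the Gram residual. -/
theorem integral_noise_le [IsProbabilityMeasure P] (hU : IsIIDNoise P U σ q K) (hq : 4 ≤ q)
    {R : ℕ} (j : Fin d)
    {W : Matrix ((k : {k : Fin d // k ≠ j}) → Fin (N k)) (Fin R) ℝ} (hW : W.transpose * W = 1)
    {t : Fin R → ℝ} (ht : ∀ r, 0 ≤ t r) :
    let c := (∏ k ∈ Finset.univ.erase j, (N k : ℝ)) * σ ^ 2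
    let f := fun ω => 3 * (2 * ∑ r, t r * ∑ i, (unfold (U ω) j * W) i r ^ 2
      + frobSq (unfold (U ω) j * (unfold (U ω) j).transpose - c • 1))
    Integrable f P ∧
      ∫ ω, f ω ∂P ≤ 3 * (2 * ∑ r, t r * (N j * σ ^ 2)
        + N j ^ 2 * ((∏ k ∈ Finset.univ.erase j, (N k : ℝ)) * (1 + K))) := by
  intro c f
  set Q : ℝ := ∏ k ∈ Finset.univ.erase j, (N k : ℝ) with hQ
  let e : Fin (N j) → ((k : {k : Fin d // k ≠ j}) → Fin (N k)) → (k : Fin d) → Fin (N k) :=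
    fun i c => (Equiv.piSplitAt j fun k => Fin (N k)).symm (i, c)
  have he {i i' c c'} (h : e i c = e i' c') : i = i' ∧ c = c' :=
    Prod.mk.inj ((Equiv.piSplitAt j fun k => Fin (N k)).symm.injective h)
  have hcard : (Fintype.card ((k : {k : Fin d // k ≠ j}) → Fin (N k)) : ℝ) = Q := by
    rw [Fintype.card_pi, hQ]
    push_cast
    simp only [Fintype.card_fin]
    exact (Finset.prod_subtype (p := (· ≠ j)) (Finset.univ.erase j) (by simp)
      fun k => (N k : ℝ)).symm
  have hG (i : Fin (N j)) (r : Fin R) :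
      Integrable (fun ω => (unfold (U ω) j * W) i r ^ 2) P ∧
        ∫ ω, (unfold (U ω) j * W) i r ^ 2 ∂P ≤ σ ^ 2 :=
    hU.integral_sum_mul_sq_le hq (φ := e i) (fun c c' h => (he h).2) (w := fun c => W c r) (by
      have h := congrFun (congrFun hW r) r
      rw [Matrix.one_apply_eq, Matrix.mul_apply] at h
      rw [← h]
      exact Finset.sum_congr rfl fun c _ => sq _)
  let Z : Ω → Matrix (Fin (N j)) (Fin (N j)) ℝ := fun ω =>
    unfold (U ω) j * (unfold (U ω) j).transpose - c • 1
  have hZ (i i' : Fin (N j)) :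
      Integrable (fun ω =>
        Z ω i i' ^ 2) P ∧
        ∫ ω, Z ω i i' ^ 2 ∂P
          ≤ Q * (1 + K) := by
    -- Rows `i` and `i'` of the unfolded noise, possibly equal: different columns involve different
    -- noise entries in either case.
    have key := hU.integral_sum_mul_sub_sq_le hq (φ := e i) (ψ := e i')
      (fun c c' h => (he h).2) (fun c c' h => (he h).2) (fun c c' h h' => h (he h').2)
      (m := if i = i' then σ ^ 2 else 0) (fun c => by
        congr 1
        exact propext ⟨fun h => by rw [h], fun h => (he h).1⟩)
    rw [hcard] at key
    have hent (ω : Ω) : Z ω i i'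
        = ∑ a, (U ω (e i a) * U ω (e i' a) - if i = i' then σ ^ 2 else 0) := by
      rw [Finset.sum_sub_distrib, Finset.sum_const, Finset.card_univ, nsmul_eq_mul, hcard]
      simp [Z, Matrix.mul_apply, unfold, e, Matrix.one_apply, c, hQ]
    simpa only [hent] using key
  have hG' (r : Fin R) : Integrable (fun ω => t r * ∑ i, (unfold (U ω) j * W) i r ^ 2) P :=
    (integrable_finsetSum _ fun i _ => (hG i r).1).const_mul _
  have hZ' (i : Fin (N j)) : Integrable (fun ω => ∑ i',
      Z ω i i' ^ 2) P :=
    integrable_finsetSum _ fun i' _ => (hZ i i').1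
  have hGs : Integrable (fun ω => 2 * ∑ r, t r * ∑ i, (unfold (U ω) j * W) i r ^ 2) P :=
    (integrable_finsetSum _ fun r _ => hG' r).const_mul _
  have hZs : Integrable (fun ω =>
      frobSq (Z ω)) P :=
    integrable_finsetSum _ fun i _ => hZ' i
  refine ⟨(hGs.add hZs).const_mul 3, ?_⟩
  simp only [f]
  rw [integral_const_mul, integral_add hGs hZs, integral_const_mul,
    integral_finsetSum _ fun r _ => hG' r]
  refine mul_le_mul_of_nonneg_left (add_le_add (mul_le_mul_of_nonneg_left
    (Finset.sum_le_sum fun r _ => ?_) (by norm_num)) ?_) (by norm_num)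
  · rw [integral_const_mul, integral_finsetSum _ fun i _ => (hG i r).1]
    refine mul_le_mul_of_nonneg_left ?_ (ht r)
    simpa using Finset.sum_le_sum fun i (_ : i ∈ Finset.univ) => (hG i r).2
  · simp only [frobSq]
    rw [integral_finsetSum _ fun i _ => hZ' i]
    calc _ ≤ ∑ _i : Fin (N j), ∑ _i' : Fin (N j), Q * (1 + K) := by
          refine Finset.sum_le_sum fun i _ => ?_
          rw [integral_finsetSum _ fun i' _ => (hZ i i').1]
          exact Finset.sum_le_sum fun i' _ => (hZ i i').2
      _ = _ := by simp; ring

end IsIIDNoise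

end Moments

/-! ### Tail bounds and rates. -/

theorem IsBigOP.trans_le {ι : Type*} {l : Filter ι} {Ω : ι → Type*} [∀ n, MeasurableSpace (Ω n)]
    {P : (n : ι) → Measure (Ω n)} {X : (n : ι) → Ω n → ℝ} {a b : ι → ℝ} (h : IsBigOP l P X a)
    {c : ℝ} (hc : 0 < c) (hab : ∀ᶠ n in l, a n ≤ c * b n) : IsBigOP l P X b := by
  intro η hη
  obtain ⟨C, hC, hCa⟩ := h η hη
  refine ⟨C * c, mul_pos hC hc, ?_⟩
  filter_upwards [hCa, hab] with n hn hn'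
  refine (measure_mono fun ω hω => ?_).trans hn
  have : C * a n ≤ C * (c * b n) := mul_le_mul_of_nonneg_left hn' hC.le
  exact lt_of_le_of_lt (this.trans_eq (mul_assoc C c (b n)).symm) hω

theorem norm21_nonneg {p R : ℕ} (A : Matrix (Fin p) (Fin R) ℝ) : 0 ≤ norm21 A :=
  Finset.sum_nonneg fun _ _ => colNorm_nonneg _ _

theorem colNorm_normalizeCols_le_one {p R : ℕ} (A : Matrix (Fin p) (Fin R) ℝ) (r : Fin R) :
    colNorm (normalizeCols A) r ≤ 1 := by
  have h : colNorm (normalizeCols A) r ^ 2 ≤ 1 := by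
    rw [colNorm_sq]
    simp only [normalizeCols, Matrix.of_apply, div_pow, ← Finset.sum_div]
    rw [← colNorm_sq]
    exact div_self_le_one _
  exact (sq_le_one_iff₀ (colNorm_nonneg _ _)).1 h

/-- Triangle inequality for columns of norm at most `1`; this settles order one, where orthonormal
right factors are not available. -/
theorem IsPCAEstimate.norm21_sub_le {p R : ℕ} {C : Type*} [Fintype C] {A : Matrix (Fin p) C ℝ}
    {V Mhat : Matrix (Fin p) (Fin R) ℝ} (hRp : R ≤ p)
    (h : IsPCAEstimate A (normalizeCols V) Mhat) :
    norm21 (Mhat - normalizeCols V) ≤ 2 * R := by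
  have key (r : Fin R) : colNorm (Mhat - normalizeCols V) r ≤ 2 := by
    have h1 := (h r (r.2.trans_le hRp)).1
    have h2 := colNorm_normalizeCols_le_one V r
    rw [colNorm_eq_norm] at h1 h2 ⊢
    exact (norm_sub_le (WithLp.toLp 2 fun i => Mhat i r)
      (WithLp.toLp 2 fun i => normalizeCols V i r)).trans (by linarith)
  simpa [norm21, mul_comm] using Finset.sum_le_sum fun r (_ : r ∈ Finset.univ) => key r

/-- A non-asymptotic tail bound for the estimation error. -/
theorem measure_norm21_gt_le {d R : ℕ} (hd : 2 ≤ d) {N : Fin d → ℕ} {Ω : Type*}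
    [MeasurableSpace Ω] {P : Measure Ω} [IsProbabilityMeasure P]
    {V : (k : Fin d) → Matrix (Fin (N k)) (Fin R) ℝ} (hV : ∀ k, ((V k).transpose * V k).IsDiag)
    {U : Ω → Tensor N} {σ q K : ℝ} (hq : 4 ≤ q) (hU : IsIIDNoise P U σ q K)
    (hN : ∀ k, 0 < N k) {g B : ℝ} (hg : 0 < g)
    (hlow : ∀ r, g ≤ scale V r ^ 2 / ∏ k, (N k : ℝ))
    (hgap : ∀ r r', r < r' → g ≤ scale V r ^ 2 / ∏ k, (N k : ℝ) - scale V r' ^ 2 / ∏ k, (N k : ℝ))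
    (hup : ∀ r, scale V r ^ 2 / ∏ k, (N k : ℝ) ≤ B) (j : Fin d) (hR : R ≤ N j)
    {Mhat : Ω → Matrix (Fin (N j)) (Fin R) ℝ}
    (hM : ∀ ω, IsPCAEstimate (unfold (signal V + U ω) j) (normalizeCols (V j)) (Mhat ω))
    {C : ℝ} (hC : 0 < C) :
    P {ω | C * Real.sqrt (1 / ∏ k ∈ Finset.univ.erase j, (N k : ℝ))
        < |norm21 (Mhat ω - normalizeCols (V j))|}
      ≤ ENNReal.ofReal (24 * R ^ 2 * (2 * R * B * σ ^ 2 + (1 + K)) / g ^ 2 / C ^ 2) := by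
  set Q : ℝ := ∏ k ∈ Finset.univ.erase j, (N k : ℝ) with hQ
  have hNpos (k : Fin d) : (0 : ℝ) < N k := Nat.cast_pos.2 (hN k)
  have hQpos : 0 < Q := Finset.prod_pos fun k _ => hNpos k
  have hprod : ∏ k, (N k : ℝ) = N j * Q :=
    (Finset.mul_prod_erase _ (fun k => (N k : ℝ)) (Finset.mem_univ j)).symm
  have hn : 0 < (N j : ℝ) * Q := mul_pos (hNpos j) hQpos
  simp only [hprod, ← sub_div, le_div_iff₀ hn, div_le_iff₀ hn] at hlow hgap hup
  have hgn : 0 < g * (N j * Q) := mul_pos hg hn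
  have hscale (r : Fin R) : scale V r ≠ 0 := fun h => by
    have := hlow r
    rw [h] at this
    linarith [zero_pow (M₀ := ℝ) two_ne_zero]
  have hMo : (normalizeCols (V j)).transpose * normalizeCols (V j) = 1 :=
    normalizeCols_orthonormal (hV j) fun r => colNorm_ne_zero_of_scale_ne_zero (hscale r) j
  have hWo := rightFactors_orthonormal hd hV hscale j
  have hmom := hU.integral_noise_le hq j hWo (t := fun r => scale V r ^ 2) fun r => sq_nonneg _
  simp only [← hQ] at hmom
  set f : Ω → ℝ := fun ω => 3 * (2 * ∑ r, scale V r ^ 2 * ∑ i,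
      (unfold (U ω) j * rightFactors V j) i r ^ 2
    + frobSq (unfold (U ω) j * (unfold (U ω) j).transpose - (Q * σ ^ 2) • 1)) with hf
  obtain ⟨hfint, hfle⟩ := hmom
  have hf0 (ω : Ω) : 0 ≤ f ω := by
    have := frobSq_nonneg (unfold (U ω) j * (unfold (U ω) j).transpose - (Q * σ ^ 2) • 1)
    positivity
  have hdet (ω : Ω) : norm21 (Mhat ω - normalizeCols (V j)) ^ 2
      ≤ 8 * R ^ 2 / (g * (N j * Q)) ^ 2 * f ω := by
    have hcol (r : Fin R) : colNorm (Mhat ω - normalizeCols (V j)) r ^ 2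
        ≤ 8 * f ω / (g * (N j * Q)) ^ 2 := by
      refine ((hM ω).colNorm_sub_sq_le hR hMo (s := fun r => scale V r ^ 2) (Q * σ ^ 2) hgn
        hlow hgap r).trans ?_
      rw [unfold_add, unfold_signal hscale]
      have := frobSq_gramResidual_le hMo hWo (scale V) (unfold (U ω) j) (Q * σ ^ 2)
      gcongr
    calc norm21 (Mhat ω - normalizeCols (V j)) ^ 2
        ≤ R * ∑ r, colNorm (Mhat ω - normalizeCols (V j)) r ^ 2 := by
          simpa [norm21] using sq_sum_le_card_mul_sum_sq (s := Finset.univ)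
            (f := colNorm (Mhat ω - normalizeCols (V j)))
      _ ≤ R * ∑ _r : Fin R, 8 * f ω / (g * (N j * Q)) ^ 2 :=
          mul_le_mul_of_nonneg_left (Finset.sum_le_sum fun r _ => hcol r) (Nat.cast_nonneg R)
      _ = _ := by
          rw [Finset.sum_const, Finset.card_univ, Fintype.card_fin, nsmul_eq_mul]; ring
  -- Squaring turns the tail event into one for the integrable majorant `f`, ready for Markov.
  have hsub : {ω | C * Real.sqrt (1 / Q) < |norm21 (Mhat ω - normalizeCols (V j))|}
      ⊆ {ω | C ^ 2 / Q ≤ 8 * R ^ 2 / (g * (N j * Q)) ^ 2 * f ω} := fun ω hω => by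
    rw [Set.mem_ofPred_eq, abs_of_nonneg (norm21_nonneg _)] at hω
    refine le_trans ?_ (hdet ω)
    have h1 := pow_le_pow_left₀ (by positivity) hω.le 2
    rwa [mul_pow, Real.sq_sqrt (by positivity), mul_one_div] at h1
  have hmarkov := mul_meas_ge_le_integral_of_nonneg (μ := P)
    (f := fun ω => 8 * R ^ 2 / (g * (N j * Q)) ^ 2 * f ω)
    (ae_of_all _ fun ω => mul_nonneg (by positivity) (hf0 ω)) (hfint.const_mul _) (C ^ 2 / Q)
  rw [integral_const_mul] at hmarkov
  refine (measure_mono hsub).trans ?_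
  rw [← ofReal_measureReal]
  refine ENNReal.ofReal_le_ofReal ?_
  have hsum : ∑ r, scale V r ^ 2 * (N j * σ ^ 2) ≤ R * (B * (N j * Q) * (N j * σ ^ 2)) := by
    simpa using Finset.sum_le_sum fun r (_ : r ∈ Finset.univ) =>
      mul_le_mul_of_nonneg_right (hup r) (by positivity : 0 ≤ (N j : ℝ) * σ ^ 2)
  have hint : ∫ ω, f ω ∂P ≤ 3 * (2 * (R * (B * (N j * Q) * (N j * σ ^ 2)))
      + N j ^ 2 * (Q * (1 + K))) := hfle.trans (by gcongr)
  have hfin := hmarkov.trans (mul_le_mul_of_nonneg_left hint (by positivity))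
  have heq : 8 * (R : ℝ) ^ 2 / (g * (N j * Q)) ^ 2 * (3 * (2 * (R * (B * (N j * Q) * (N j * σ ^ 2)))
      + N j ^ 2 * (Q * (1 + K)))) = 24 * R ^ 2 * (2 * R * B * σ ^ 2 + (1 + K)) / g ^ 2 / Q := by
    have := (hNpos j).ne'
    field_simp
    ring
  rw [heq, div_mul_eq_mul_div, div_le_div_iff_of_pos_right hQpos] at hfin
  rw [le_div_iff₀ (by positivity), mul_comm]
  exact hfin

/-- The separation constants of a strictly decreasing positive family. -/
theorem exists_pos_lt_gap {R : ℕ} {δ : Fin R → ℝ} (hδ : StrictAnti δ) (hδpos : ∀ r, 0 < δ r) :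
    ∃ g : ℝ, 0 < g ∧ (∀ r, g < δ r) ∧ ∀ r r', r < r' → g < δ r - δ r' := by
  -- Every sufficiently small `g > 0` meets the finitely many conditions; this avoids a minimum over
  -- a possibly empty family.
  have hlt {x : ℝ} (hx : 0 < x) : ∀ᶠ g in 𝓝[>] (0 : ℝ), g < x :=
    nhdsWithin_le_nhds (eventually_lt_nhds hx)
  have h : ∀ᶠ g in 𝓝[>] (0 : ℝ), 0 < g ∧ (∀ r, g < δ r) ∧ ∀ r r', r < r' → g < δ r - δ r' :=
    eventually_mem_nhdsWithin.and <| (eventually_all.2 fun r => hlt (hδpos r)).and <|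
      eventually_all.2 fun r => eventually_all.2 fun r' => by
        by_cases hr : r < r'
        · filter_upwards [hlt (sub_pos.2 (hδ hr))] with g hg _ using hg
        · exact Eventually.of_forall fun g h => absurd h hr
  exact h.exists

/-- The rate of PCA on an unfolding of a tensor of order at least two. -/
theorem isBigOP_norm21_of_two_le {ι : Type*} {l : Filter ι} {d R : ℕ} (hd : 2 ≤ d)
    {N : ι → Fin d → ℕ} (hN : ∀ k, Tendsto (fun n => N n k) l atTop)
    {Ω : ι → Type*} [∀ n, MeasurableSpace (Ω n)]
    {P : (n : ι) → Measure (Ω n)} [∀ n, IsProbabilityMeasure (P n)]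
    {V : (n : ι) → (k : Fin d) → Matrix (Fin (N n k)) (Fin R) ℝ}
    {U : (n : ι) → Ω n → Tensor (N n)}
    (hV : ∀ n k, ((V n k).transpose * V n k).IsDiag)
    {σ q K : ℝ} (hq : 4 ≤ q) (hU : ∀ n, IsIIDNoise (P n) (U n) σ q K)
    {δ : Fin R → ℝ} (hδ : StrictAnti δ) (hδpos : ∀ r, 0 < δ r)
    (hσ : ∀ r, Tendsto (fun n => scale (V n) r ^ 2 / ∏ k, (N n k : ℝ)) l (𝓝 (δ r)))
    (j : Fin d) {Mhat : (n : ι) → Ω n → Matrix (Fin (N n j)) (Fin R) ℝ}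
    (hM : ∀ n ω, IsPCAEstimate (unfold (signal (V n) + U n ω) j)
      (normalizeCols (V n j)) (Mhat n ω)) :
    IsBigOP l P (fun n ω => norm21 (Mhat n ω - normalizeCols (V n j)))
      (fun n => Real.sqrt (1 / ∏ k ∈ Finset.univ.erase j, (N n k : ℝ))) := by
  intro η hη
  obtain ⟨g, hg, hgδ, hggap⟩ := exists_pos_lt_gap hδ hδpos
  obtain ⟨B, hB⟩ := ((eventually_all (l := atTop)).2 fun r : Fin R => eventually_gt_atTop (δ r)).exists
  set L := 24 * R ^ 2 * (2 * R * B * σ ^ 2 + (1 + K)) / g ^ 2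
  have hLη : 0 ≤ |L| / η := by positivity
  -- Chosen so that `L / C ^ 2 ≤ η`; the `+ 1` keeps `C` positive, and `|L|` avoids a discussion of
  -- signs.
  refine ⟨Real.sqrt (|L| / η) + 1, by positivity, ?_⟩
  have hpos : ∀ᶠ n in l, ∀ k, 0 < N n k := eventually_all.2 fun k => (hN k).eventually_gt_atTop 0
  have hlow := eventually_all.2 fun r => (hσ r).eventually_const_le (hgδ r)
  have hup := eventually_all.2 fun r => (hσ r).eventually_le_const (hB r)
  have hgap : ∀ᶠ n in l, ∀ r r', r < r' →
      g ≤ scale (V n) r ^ 2 / ∏ k, (N n k : ℝ) - scale (V n) r' ^ 2 / ∏ k, (N n k : ℝ) :=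
    eventually_all.2 fun r => eventually_all.2 fun r' => by
      by_cases hr : r < r'
      · filter_upwards [((hσ r).sub (hσ r')).eventually_const_le (hggap r r' hr)] with n hn _ using hn
      · exact Eventually.of_forall fun n h => absurd h hr
  filter_upwards [hpos, hlow, hup, hgap, (hN j).eventually_ge_atTop R] with n h1 h2 h3 h4 h5
  refine (measure_norm21_gt_le hd (hV n) hq (hU n) h1 hg h2 h4 h3 j h5 (hM n)
    (by positivity)).trans (ENNReal.ofReal_le_ofReal ?_)
  rw [div_le_iff₀ (by positivity)]
  calc L ≤ |L| := le_abs_self L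
    _ = η * Real.sqrt (|L| / η) ^ 2 := by rw [Real.sq_sqrt hLη]; field_simp
    _ ≤ η * (Real.sqrt (|L| / η) + 1) ^ 2 := by gcongr; linarith

/-- If all dimensions are proportional to `S`, so are `√(∏_{k ≠ j} N k)` and `N j` for order
three. -/
theorem exists_rate_le_of_isTheta {ι : Type*} {l : Filter ι} {d : ℕ} (hd : d = 3)
    {N : ι → Fin d → ℕ} (hN : ∀ k, Tendsto (fun n => N n k) l atTop) {S : ι → ℕ}
    (hS : ∀ k, Asymptotics.IsTheta l (fun n => (N n k : ℝ)) (fun n => (S n : ℝ))) (j : Fin d) :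
    ∃ c : ℝ, 0 < c ∧ ∀ᶠ n in l,
      max (Real.sqrt (1 / ∏ k ∈ Finset.univ.erase j, (N n k : ℝ))) (1 / (N n j : ℝ))
        ≤ c * (1 / (S n : ℝ)) := by
  -- Every large enough constant witnesses each big-O, so one positive `c` serves all modes.
  obtain ⟨c, hcS, hc⟩ := ((eventually_all.2 fun k =>
    Asymptotics.isBigO_iff_eventually.1 (hS k).2).and (eventually_gt_atTop (0 : ℝ))).exists
  obtain ⟨c', hc'⟩ := Asymptotics.isBigO_iff.1 (hS j).1
  refine ⟨c, hc, ?_⟩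
  filter_upwards [eventually_all.2 hcS, hc', (hN j).eventually_gt_atTop 0] with n h1 h2 h3
  simp only [Real.norm_natCast] at h1 h2
  have hS0 : (0 : ℝ) < S n := by
    rcases (Nat.cast_nonneg (α := ℝ) (S n)).eq_or_lt with h | h
    · rw [← h, mul_zero] at h2
      exact absurd (Nat.cast_pos.2 h3) h2.not_gt
    · exact h
  have h4 (k : Fin d) : (S n : ℝ) / c ≤ N n k := by
    rw [div_le_iff₀ hc, mul_comm]; exact h1 k
  have hSc : 0 < (S n : ℝ) / c := div_pos hS0 hc
  have hcard : (Finset.univ.erase j).card = 2 := by simp [hd]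
  have hprod : ((S n : ℝ) / c) ^ 2 ≤ ∏ k ∈ Finset.univ.erase j, (N n k : ℝ) := by
    rw [← hcard, ← Finset.prod_const]
    exact Finset.prod_le_prod (fun _ _ => hSc.le) fun k _ => h4 k
  have heq : c * (1 / (S n : ℝ)) = 1 / ((S n : ℝ) / c) := by field_simp
  rw [heq]
  refine max_le ?_ (one_div_le_one_div_of_le hSc (h4 j))
  rw [← Real.sqrt_sq (one_div_pos.2 hSc).le, one_div_pow]
  exact Real.sqrt_le_sqrt (one_div_le_one_div_of_le (by positivity) hprod)

end TensorPCA

/-- `n : ι` indexes the data sets, and all the sizes `N n k` tend to infinity along `l`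
(for instance `ι = Fin d → ℕ`, `N n = n` and `l = atTop`, or a sequence of sizes). -/
theorem corollary1 {ι : Type*} (l : Filter ι) (d R : ℕ)
    (N : ι → Fin d → ℕ) (hN : ∀ k, Tendsto (fun n => N n k) l atTop)
    {Ω : ι → Type*} [∀ n, MeasurableSpace (Ω n)]
    (P : (n : ι) → Measure (Ω n)) [∀ n, IsProbabilityMeasure (P n)]
    -- the unnormalized loadings/factors: `V n k` has the columns `v_{k,1}, …, v_{k,R}`
    (V : (n : ι) → (k : Fin d) → Matrix (Fin (N n k)) (Fin R) ℝ)
    -- the idiosyncratic errors, and the observed tensor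
    (U Y : (n : ι) → Ω n → TensorPCA.Tensor (N n))
    (hY : ∀ n ω, Y n ω = TensorPCA.signal (V n) + U n ω)
    -- the loadings/factors are orthogonal
    (hV : ∀ n k, ((V n k).transpose * V n k).IsDiag)
    -- the errors are i.i.d. and centred, with variance `σ ^ 2` and `4 + ε` moments
    (σ ε K : ℝ) (hε : 0 < ε)
    (hU : ∀ n, TensorPCA.IsIIDNoise (P n) (U n) σ (4 + ε) K)
    -- the factors are pervasive
    (δ : Fin R → ℝ) (hδ : StrictAnti δ) (hδpos : ∀ r, 0 < δ r)
    (hσ : ∀ r, Tendsto (fun n => TensorPCA.scale (V n) r ^ 2 / ∏ k, (N n k : ℝ)) l (𝓝 (δ r)))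
    -- the estimator of `M_j` is PCA on the mode-`j` unfolding
    (j : Fin d)
    (Mhat : (n : ι) → Ω n → Matrix (Fin (N n j)) (Fin R) ℝ)
    (hM : ∀ n ω, TensorPCA.IsPCAEstimate (TensorPCA.unfold (Y n ω) j)
      (TensorPCA.normalizeCols (V n j)) (Mhat n ω)) :
    TensorPCA.IsBigOP l P
      (fun n ω => TensorPCA.norm21 (Mhat n ω - TensorPCA.normalizeCols (V n j)))
      (fun n => max (Real.sqrt (1 / ∏ k ∈ Finset.univ.erase j, (N n k : ℝ)))
        (1 / (N n j : ℝ))) ∧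
    -- three dimensions that grow proportionally to `S`
    (d = 3 → ∀ S : ι → ℕ,
      (∀ k, Asymptotics.IsTheta l (fun n => (N n k : ℝ)) (fun n => (S n : ℝ))) →
      TensorPCA.IsBigOP l P
        (fun n ω => TensorPCA.norm21 (Mhat n ω - TensorPCA.normalizeCols (V n j)))
        (fun n => 1 / (S n : ℝ))) := by
  have key : TensorPCA.IsBigOP l P
      (fun n ω => TensorPCA.norm21 (Mhat n ω - TensorPCA.normalizeCols (V n j)))
      (fun n => max (Real.sqrt (1 / ∏ k ∈ Finset.univ.erase j, (N n k : ℝ)))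
        (1 / (N n j : ℝ))) := by
    rcases le_or_gt 2 d with hd | hd
    · refine (TensorPCA.isBigOP_norm21_of_two_le hd hN hV (by linarith) hU hδ hδpos hσ j
        fun n ω => hY n ω ▸ hM n ω).trans_le one_pos (Eventually.of_forall fun n => ?_)
      rw [one_mul]
      exact le_max_left _ _
    · intro η _
      -- The rate is at least `1` and the error at most `2 * R`, so the bad event is empty once `R ≤
      -- N n j`.
      refine ⟨2 * R + 1, by positivity, ?_⟩
      filter_upwards [(hN j).eventually_ge_atTop R] with n hn
      have hone : (∏ k ∈ Finset.univ.erase j, (N n k : ℝ)) = 1 := by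
        have : Subsingleton (Fin d) := Fin.subsingleton_iff_le_one.2 (by omega)
        exact Finset.prod_eq_one fun k hk => absurd (Subsingleton.elim k j) (Finset.ne_of_mem_erase hk)
      refine (measure_mono_null (t := ∅) (fun ω hω => ?_) measure_empty).le.trans zero_le
      have h1 := (hM n ω).norm21_sub_le hn
      have h2 : (1 : ℝ) ≤ max (Real.sqrt (1 / ∏ k ∈ Finset.univ.erase j, (N n k : ℝ)))
          (1 / (N n j : ℝ)) := le_max_of_le_left (by rw [hone]; simp)
      rw [Set.mem_ofPred_eq, abs_of_nonneg (TensorPCA.norm21_nonneg _)] at hω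
      have h3 : (0 : ℝ) ≤ 2 * R + 1 := by positivity
      nlinarith
  refine ⟨key, fun hd S hS => ?_⟩
  obtain ⟨c, hc, hle⟩ := TensorPCA.exists_rate_le_of_isTheta hd hN hS j
  exact key.trans_le hc hle
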